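/- A \emph{pseudoline} in the Euclidean plane $\mathbb E$ is the image of a straight line under a homeomorphism of $\mathbb E$ onto itself. A \emph{Euclidean arrangement of pseudolines} is a finite set $\mathcal L$ of pseudolines in $\mathbb E$ any two of which intersect in exactly one point and cross there; it is \emph{simple} if no point belongs to more than two of its pseudolines. The \emph{polygons} of $\mathcal L$ are the bounded connected components of $\mathbb E\setminus\bigcup_{\ell\in\mathcal L}\ell$. The \emph{edges} of $\mathcal L$ are the connected components of the sets $\ell\setminus\bigcup_{m\in\mathcal L\setminus\{\ell\}}m$, $\ell\in\mathcal L$, and the edges of a polygon are those edges of $\mathcal L$ that are contained in its boundary. A \emph{triangle} of $\mathcal L$ is a polygon with exactly three edges, and a \emph{$(\ge 5)$-gon} of $\mathcal L$ is a polygon with at least five edges. A pseudoline is \emph{adjacent} to a polygon if it contains an edge of the polygon. Let $\Im$ be the set of all simple Euclidean arrangements of pseudolines that have exactly one $(\ge 5)$-gon and in which every pseudoline is adjacent to that $(\ge 5)$-gon. \textbf{Proposition.} If $\mathcal L\in\Im$, then every triangle of $\mathcal L$ has a common edge with the $(\ge 5)$-gon of $\mathcal L$. -/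

import Mathlib

namespace Pseudolines

/-- The Euclidean plane. -/
abbrev Plane : Type := EuclideanSpace ℝ (Fin 2)

/-- A pseudoline in the Euclidean plane: the image of a straight line under a homeomorphism of the
plane onto itself. -/
def IsPseudoline (ℓ : Set Plane) : Prop :=
  ∃ φ : Plane ≃ₜ Plane, ℓ = φ '' {x : Plane | x 1 = 0}

/-- `ℓ` and `m` have exactly one common point, and `m` crosses `ℓ`: it visits two different sides
(connected components of the complement) of `ℓ`. -/
def CrossesOnce (ℓ m : Set Plane) : Prop :=
  (∃ v, ℓ ∩ m = {v}) ∧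
    ∃ x ∈ m \ ℓ, ∃ y ∈ m \ ℓ, connectedComponentIn ℓᶜ x ≠ connectedComponentIn ℓᶜ y

/-- A Euclidean arrangement of pseudolines: a finite set of pseudolines in the plane that pairwise
intersect exactly once, and cross there. -/
structure IsArrangement (𝓛 : Set (Set Plane)) : Prop where
  finite : 𝓛.Finite
  isPseudoline : ∀ ℓ ∈ 𝓛, IsPseudoline ℓ
  crossesOnce : ∀ ℓ ∈ 𝓛, ∀ m ∈ 𝓛, ℓ ≠ m → CrossesOnce ℓ m

/-- A simple arrangement: no point belongs to more than two pseudolines. -/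
structure IsSimpleArrangement (𝓛 : Set (Set Plane)) : Prop extends IsArrangement 𝓛 where
  simple : ∀ x : Plane, {ℓ ∈ 𝓛 | x ∈ ℓ}.encard ≤ 2

/-- The (two-dimensional open) cells: the connected components of the complement of the union of
the pseudolines. -/
def IsCell (𝓛 : Set (Set Plane)) (C : Set Plane) : Prop :=
  ∃ x ∈ (⋃₀ 𝓛)ᶜ, C = connectedComponentIn (⋃₀ 𝓛)ᶜ x

/-- A polygon (face) of the arrangement: a bounded cell. -/
def IsPolygon (𝓛 : Set (Set Plane)) (C : Set Plane) : Prop :=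
  IsCell 𝓛 C ∧ Bornology.IsBounded C

/-- `e` is an edge of the arrangement lying on its pseudoline `ℓ`: a connected component of what
remains of `ℓ` when the other pseudolines are removed (edges are taken without endpoints). -/
def IsEdgeOn (𝓛 : Set (Set Plane)) (ℓ e : Set Plane) : Prop :=
  ∃ x ∈ ℓ \ ⋃₀ (𝓛 \ {ℓ}), e = connectedComponentIn (ℓ \ ⋃₀ (𝓛 \ {ℓ})) x

/-- The edges of the cell `C`: the edges of the arrangement that lie on the boundary of `C`. -/
def edges (𝓛 : Set (Set Plane)) (C : Set Plane) : Set (Set Plane) :=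
  {e | (∃ ℓ ∈ 𝓛, IsEdgeOn 𝓛 ℓ e) ∧ e ⊆ frontier C}

/-- The pseudoline `ℓ` is adjacent to the cell `C`: `C` has an edge on `ℓ`. -/
def Adjacent (𝓛 : Set (Set Plane)) (ℓ C : Set Plane) : Prop :=
  ∃ e ∈ edges 𝓛 C, IsEdgeOn 𝓛 ℓ e

/-- A triangle of the arrangement: a polygon with exactly three edges. -/
def IsTriangle (𝓛 : Set (Set Plane)) (T : Set Plane) : Prop :=
  IsPolygon 𝓛 T ∧ (edges 𝓛 T).encard = 3

/-- A `(≥ 5)`-gon of the arrangement: a polygon with at least five edges. -/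
def IsGeFiveGon (𝓛 : Set (Set Plane)) (P : Set Plane) : Prop :=
  IsPolygon 𝓛 P ∧ 5 ≤ (edges 𝓛 P).encard

/-- The class of simple Euclidean arrangements of pseudolines with exactly one `(≥ 5)`-gon in which
every pseudoline is adjacent to that `(≥ 5)`-gon. -/
def ImClass : Set (Set (Set Plane)) :=
  {𝓛 | IsSimpleArrangement 𝓛 ∧
    ∃ P, IsGeFiveGon 𝓛 P ∧ (∀ Q, IsGeFiveGon 𝓛 Q → Q = P) ∧ ∀ ℓ ∈ 𝓛, Adjacent 𝓛 ℓ P}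

end Pseudolines

namespace Pseudolines

open Set Topology

/-! A parity argument on the three pseudolines `a`, `b`, `c` that carry the edges of the triangle
`T`. Suppose `T` and the (≥ 5)-gon `P` share no edge. Both have an edge on `a`. The edge of `T` ends
at `b` on one side and at `c` on the other, and since `b` and `c` cross `a` only there, the edge of
`P` on `a` lies beyond exactly one of these ends. Hence exactly one of `b`, `c` separates `T` from
`P` (`common_edge_or_separates`). The same holds on `b` and on `c`, so among three truth values any
two differ, which is impossible.

The topological work is to show that an edge of a bounded cell has two ends on distinct pseudolines,
each again adjacent to the cell (`IsCell.exists_ends`, resting on `IsCell.adjacent_of_vertex`), so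
that for a triangle these are the two remaining ones (`IsTriangle.exists_lines`). Sides are read off
from signs of `height`. -/

/-! ### Charts of a pseudoline -/

/-- The height of a point above the pseudoline with chart `φ`. -/
noncomputable def height (φ : Plane ≃ₜ Plane) (x : Plane) : ℝ := (φ.symm x) 1

/-- The parametrization of the pseudoline with chart `φ`. -/
noncomputable def curve (φ : Plane ≃ₜ Plane) (t : ℝ) : Plane := φ !₂[t, 0]

/-- The part of the plane above the pseudoline with chart `φ`, near the point `φ p`. -/
def upperPart (φ : Plane ≃ₜ Plane) (p : Plane) (r : ℝ) : Set Plane :=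
  φ '' (Metric.ball p r ∩ {x | 0 < x 1})

theorem continuous_height (φ : Plane ≃ₜ Plane) : Continuous (height φ) := by
  unfold height
  fun_prop

theorem continuous_curve (φ : Plane ≃ₜ Plane) : Continuous (curve φ) := by
  unfold curve
  refine φ.continuous.comp ((PiLp.continuous_toLp 2 _).comp (continuous_pi fun i => ?_))
  fin_cases i
  · exact continuous_id
  · exact continuous_const

theorem mem_iff_height {φ : Plane ≃ₜ Plane} {ℓ : Set Plane} (h : ℓ = φ '' {x : Plane | x 1 = 0})
    (x : Plane) : x ∈ ℓ ↔ height φ x = 0 := by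
  subst h
  rw [φ.image_eq_preimage_symm]
  rfl

theorem curve_mem {φ : Plane ≃ₜ Plane} {ℓ : Set Plane} (h : ℓ = φ '' {x : Plane | x 1 = 0})
    (t : ℝ) : curve φ t ∈ ℓ := by
  rw [mem_iff_height h]
  simp [height, curve]

theorem exists_curve_eq {φ : Plane ≃ₜ Plane} {ℓ : Set Plane} (h : ℓ = φ '' {x : Plane | x 1 = 0})
    {x : Plane} (hx : x ∈ ℓ) : ∃ t, curve φ t = x := by
  subst h
  obtain ⟨y, hy, rfl⟩ := hx
  refine ⟨y 0, ?_⟩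
  unfold curve
  congr 1
  ext i
  fin_cases i
  · rfl
  · exact hy.symm

theorem curve_injective (φ : Plane ≃ₜ Plane) : Function.Injective (curve φ) := by
  intro s t h
  have := congrArg (fun x : Plane => x 0) (φ.injective h)
  simpa using this

theorem isClosed_of_chart {φ : Plane ≃ₜ Plane} {ℓ : Set Plane}
    (h : ℓ = φ '' {x : Plane | x 1 = 0}) : IsClosed ℓ := by
  have : ℓ = height φ ⁻¹' {0} := by
    ext x
    simpa using mem_iff_height h x
  rw [this]
  exact isClosed_singleton.preimage (continuous_height φ)

/-- The parametrization of a pseudoline is proper. -/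
theorem isBounded_preimage_curve (φ : Plane ≃ₜ Plane) {B : Set Plane}
    (hB : Bornology.IsBounded B) : Bornology.IsBounded (curve φ ⁻¹' B) := by
  have h1 : IsCompact (φ.symm '' closure B) := hB.isCompact_closure.image φ.symm.continuous
  have h2 : IsCompact ((fun x : Plane => x 0) '' (φ.symm '' closure B)) :=
    h1.image (by fun_prop)
  refine h2.isBounded.subset fun t ht => ?_
  exact ⟨!₂[t, 0], ⟨curve φ t, subset_closure ht, by simp [curve]⟩, by simp⟩

theorem isPreconnected_upperPart (φ : Plane ≃ₜ Plane) (p : Plane) (r : ℝ) :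
    IsPreconnected (upperPart φ p r) := by
  refine IsPreconnected.image (Convex.isPreconnected ?_) _ φ.continuous.continuousOn
  refine (convex_ball p r).inter (convex_halfSpace_gt (f := fun x : Plane => x 1) ?_ 0)
  exact ⟨fun _ _ => rfl, fun _ _ => rfl⟩

theorem isPreconnected_setOf_height_pos (φ : Plane ≃ₜ Plane) :
    IsPreconnected {x | 0 < height φ x} := by
  have : {x | 0 < height φ x} = φ '' {x : Plane | 0 < x 1} := by
    rw [φ.image_eq_preimage_symm]; rfl
  rw [this]
  refine IsPreconnected.image (Convex.isPreconnected ?_) _ φ.continuous.continuousOn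
  refine convex_halfSpace_gt (f := fun x : Plane => x 1) ?_ 0
  exact ⟨fun _ _ => rfl, fun _ _ => rfl⟩

theorem mem_upperPart {φ : Plane ≃ₜ Plane} {p : Plane} {r : ℝ} {x : Plane} :
    x ∈ upperPart φ p r ↔ x ∈ φ '' Metric.ball p r ∧ 0 < height φ x := by
  unfold upperPart
  simp only [φ.image_eq_preimage_symm]
  rfl

theorem exists_ball_subset (φ : Plane ≃ₜ Plane) {U : Set Plane} (hU : IsOpen U) {x : Plane}
    (hx : x ∈ U) : ∃ r > 0, φ '' Metric.ball (φ.symm x) r ⊆ U := by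
  obtain ⟨r, hr, h⟩ := Metric.isOpen_iff.1 (hU.preimage φ.continuous) (φ.symm x) (by simpa using hx)
  exact ⟨r, hr, image_subset_iff.2 h⟩

/-- Composing a chart with the point reflection exchanges the two sides. -/
theorem height_neg (φ : Plane ≃ₜ Plane) (x : Plane) :
    height ((Homeomorph.neg Plane).trans φ) x = -height φ x := by
  rfl

theorem chart_neg {φ : Plane ≃ₜ Plane} {ℓ : Set Plane} (h : ℓ = φ '' {x : Plane | x 1 = 0}) :
    ℓ = (Homeomorph.neg Plane).trans φ '' {x : Plane | x 1 = 0} := by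
  ext x
  rw [mem_iff_height h, ((Homeomorph.neg Plane).trans φ).image_eq_preimage_symm]
  change _ ↔ height ((Homeomorph.neg Plane).trans φ) x = 0
  rw [height_neg, neg_eq_zero]

theorem height_pos_or_neg {φ : Plane ≃ₜ Plane} {ℓ T : Set Plane}
    (h : ℓ = φ '' {x : Plane | x 1 = 0}) (hT : IsPreconnected T) (hd : Disjoint T ℓ) :
    (∀ x ∈ T, 0 < height φ x) ∨ ∀ x ∈ T, height φ x < 0 := by
  have hc := continuous_height φ
  have := hT.subset_or_subset (isOpen_lt continuous_const hc) (isOpen_lt hc continuous_const)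
    (u := {x | 0 < height φ x}) (v := {x | height φ x < 0})
    (disjoint_left.2 fun x h1 h2 => lt_asymm (a := (0 : ℝ)) (b := height φ x) h1 h2) (fun x hx => by
      have : height φ x ≠ 0 := fun h0 => disjoint_left.1 hd hx ((mem_iff_height h x).2 h0)
      exact this.lt_or_gt.symm)
  exact this

theorem exists_chart_pos {ℓ T : Set Plane} (hℓ : IsPseudoline ℓ) (hT : IsPreconnected T)
    (hd : Disjoint T ℓ) :
    ∃ φ : Plane ≃ₜ Plane, ℓ = φ '' {x : Plane | x 1 = 0} ∧ ∀ x ∈ T, 0 < height φ x := by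
  obtain ⟨φ, h⟩ := hℓ
  rcases height_pos_or_neg h hT hd with h1 | h1
  · exact ⟨φ, h, h1⟩
  · refine ⟨_, chart_neg h, fun x hx => ?_⟩
    rw [height_neg]
    linarith [h1 x hx]

/-! ### Crossings as sign changes -/

/-- A continuous function of both signs with a single zero changes its sign there. -/
theorem sign_change {g : ℝ → ℝ} (hg : Continuous g) {t₀ : ℝ} (h0 : ∀ t, g t = 0 ↔ t = t₀)
    (hn : ∃ a, g a < 0) (hp : ∃ b, 0 < g b) :
    (∀ t, (g t < 0 ↔ t < t₀) ∧ (0 < g t ↔ t₀ < t)) ∨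
      ∀ t, (g t < 0 ↔ t₀ < t) ∧ (0 < g t ↔ t < t₀) := by
  have key : ∀ s t, g s < 0 → 0 < g t → (s < t₀ ∧ t₀ < t) ∨ (t < t₀ ∧ t₀ < s) := by
    intro s t hs ht
    obtain ⟨u, hu, hu0⟩ := intermediate_value_uIcc (a := s) (b := t) hg.continuousOn
      (mem_uIcc.2 (Or.inl ⟨hs.le, ht.le⟩) : (0 : ℝ) ∈ uIcc (g s) (g t))
    rw [h0] at hu0
    subst hu0
    have h1 : s ≠ u := fun h => hs.ne ((h0 s).2 h)
    have h2 : t ≠ u := fun h => ht.ne' ((h0 t).2 h)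
    rcases mem_uIcc.1 hu with h | h
    · exact Or.inl ⟨lt_of_le_of_ne h.1 h1, lt_of_le_of_ne h.2 h2.symm⟩
    · exact Or.inr ⟨lt_of_le_of_ne h.1 h2, lt_of_le_of_ne h.2 h1.symm⟩
  obtain ⟨a, ha⟩ := hn
  obtain ⟨b, hb⟩ := hp
  rcases key a b ha hb with h | h
  · left
    intro t
    rcases lt_trichotomy (g t) 0 with h1 | h1 | h1
    · have := key t b h1 hb
      grind
    · have := (h0 t).1 h1
      grind
    · have := key a t ha h1
      grind
  · right
    intro t
    rcases lt_trichotomy (g t) 0 with h1 | h1 | h1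
    · have := key t b h1 hb
      grind
    · have := (h0 t).1 h1
      grind
    · have := key a t ha h1
      grind

/-- The second of two crossing pseudolines changes its side of the first at the crossing. -/
theorem CrossesOnce.sign_change {ℓ m : Set Plane} {φ ψ : Plane ≃ₜ Plane} (h : CrossesOnce ℓ m)
    (hℓ : ℓ = φ '' {x : Plane | x 1 = 0}) (hm : m = ψ '' {x : Plane | x 1 = 0})
    {t₀ : ℝ} (ht₀ : curve ψ t₀ ∈ ℓ) :
    (∀ t, (height φ (curve ψ t) < 0 ↔ t < t₀) ∧ (0 < height φ (curve ψ t) ↔ t₀ < t)) ∨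
      ∀ t, (height φ (curve ψ t) < 0 ↔ t₀ < t) ∧ (0 < height φ (curve ψ t) ↔ t < t₀) := by
  obtain ⟨⟨v, hv⟩, x, hx, y, hy, hxy⟩ := h
  have hmem : ∀ t, curve ψ t ∈ ℓ → curve ψ t = v := fun t ht => by
    have : curve ψ t ∈ ℓ ∩ m := ⟨ht, curve_mem hm t⟩
    rwa [hv] at this
  -- Two points above `ℓ` lie in one component of its complement. Quantifying over charts lets
  -- `chart_neg` give the same for points below.
  have hpos : ∀ φ : Plane ≃ₜ Plane, ℓ = φ '' {x : Plane | x 1 = 0} →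
      ¬ (0 < height φ x ∧ 0 < height φ y) := by
    intro φ hℓ hh
    apply hxy
    refine connectedComponentIn_eq ?_
    refine (isPreconnected_setOf_height_pos φ).subset_connectedComponentIn hh.1 ?_ hh.2
    intro z hz hz'
    exact (ne_of_gt hz) ((mem_iff_height hℓ z).1 hz')
  have h1 := hpos φ hℓ
  have h2 := hpos _ (chart_neg hℓ)
  rw [height_neg, height_neg] at h2
  have hx0 : height φ x ≠ 0 := fun h => hx.2 ((mem_iff_height hℓ x).2 h)
  have hy0 : height φ y ≠ 0 := fun h => hy.2 ((mem_iff_height hℓ y).2 h)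
  obtain ⟨s, rfl⟩ := exists_curve_eq hm hx.1
  obtain ⟨t, rfl⟩ := exists_curve_eq hm hy.1
  refine Pseudolines.sign_change (g := fun t => height φ (curve ψ t))
    ((continuous_height φ).comp (continuous_curve ψ)) (fun u => ?_) ?_ ?_
  · rw [← mem_iff_height hℓ]
    exact ⟨fun hu => curve_injective ψ ((hmem u hu).trans (hmem t₀ ht₀).symm), fun hu => hu ▸ ht₀⟩
  · rcases hx0.lt_or_gt with h | h
    · exact ⟨s, h⟩
    · exact ⟨t, by by_contra!; exact h1 ⟨h, lt_of_le_of_ne this hy0.symm⟩⟩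
  · rcases hx0.lt_or_gt with h | h
    · exact ⟨t, by by_contra!; exact h2 ⟨neg_pos.2 h, neg_pos.2 (lt_of_le_of_ne this hy0)⟩⟩
    · exact ⟨s, h⟩

/-! ### Cells and their boundaries -/

theorem IsCell.isPreconnected {𝓛 : Set (Set Plane)} {T : Set Plane} (hT : IsCell 𝓛 T) :
    IsPreconnected T := by
  obtain ⟨x, -, rfl⟩ := hT
  exact isPreconnected_connectedComponentIn

theorem IsCell.nonempty {𝓛 : Set (Set Plane)} {T : Set Plane} (hT : IsCell 𝓛 T) :
    T.Nonempty := by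
  obtain ⟨x, hx, rfl⟩ := hT
  exact ⟨x, mem_connectedComponentIn hx⟩

theorem IsCell.notMem_sUnion {𝓛 : Set (Set Plane)} {T : Set Plane} (hT : IsCell 𝓛 T) {x : Plane}
    (hx : x ∈ T) : x ∉ ⋃₀ 𝓛 := by
  obtain ⟨y, -, rfl⟩ := hT
  exact connectedComponentIn_subset _ _ hx

theorem IsCell.disjoint {𝓛 : Set (Set Plane)} {T ℓ : Set Plane} (hT : IsCell 𝓛 T) (hℓ : ℓ ∈ 𝓛) :
    Disjoint T ℓ :=
  disjoint_left.2 fun _ hx hxℓ => hT.notMem_sUnion hx ⟨ℓ, hℓ, hxℓ⟩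

theorem IsCell.subset_of_isPreconnected {𝓛 : Set (Set Plane)} {T S : Set Plane} (hT : IsCell 𝓛 T)
    (hS : IsPreconnected S) (hd : S ⊆ (⋃₀ 𝓛)ᶜ) (h : (S ∩ T).Nonempty) : S ⊆ T := by
  obtain ⟨x, -, rfl⟩ := hT
  obtain ⟨y, hyS, hy⟩ := h
  rw [connectedComponentIn_eq hy]
  exact hS.subset_connectedComponentIn hyS hd

theorem IsArrangement.isClosed_sUnion {𝓛 𝓜 : Set (Set Plane)} (h : IsArrangement 𝓛)
    (hM : 𝓜 ⊆ 𝓛) : IsClosed (⋃₀ 𝓜) := by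
  rw [sUnion_eq_biUnion]
  refine (h.finite.subset hM).isClosed_biUnion fun ℓ hℓ => ?_
  obtain ⟨φ, hφ⟩ := h.isPseudoline ℓ (hM hℓ)
  exact isClosed_of_chart hφ

theorem IsCell.isOpen {𝓛 : Set (Set Plane)} {T : Set Plane} (hT : IsCell 𝓛 T)
    (h : IsArrangement 𝓛) : IsOpen T := by
  obtain ⟨x, -, rfl⟩ := hT
  exact (h.isClosed_sUnion subset_rfl).isOpen_compl.connectedComponentIn

/-- The component of `x` in the complement is open, so it meets the cell and is contained in it. -/
theorem IsCell.mem_of_mem_closure {𝓛 : Set (Set Plane)} {T : Set Plane} (hT : IsCell 𝓛 T)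
    (h : IsArrangement 𝓛) {x : Plane} (hx : x ∈ closure T) (hx' : x ∉ ⋃₀ 𝓛) : x ∈ T := by
  have ho : IsOpen (connectedComponentIn (⋃₀ 𝓛)ᶜ x) :=
    (h.isClosed_sUnion subset_rfl).isOpen_compl.connectedComponentIn
  exact hT.subset_of_isPreconnected isPreconnected_connectedComponentIn
    (connectedComponentIn_subset _ _)
    (mem_closure_iff.1 hx _ ho (mem_connectedComponentIn hx')) (mem_connectedComponentIn hx')

theorem notMem_of_mem_diff {𝓛 : Set (Set Plane)} {ℓ m : Set Plane} {x : Plane}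
    (hx : x ∈ ℓ \ ⋃₀ (𝓛 \ {ℓ})) (hm : m ∈ 𝓛) (hne : m ≠ ℓ) : x ∉ m :=
  fun h => hx.2 ⟨m, ⟨hm, hne⟩, h⟩

/-- Near a point of a pseudoline on the boundary of a cell and on no other pseudoline, the
pseudoline stays on the boundary. -/
theorem IsCell.exists_nhds_subset_closure {𝓛 : Set (Set Plane)} {T ℓ : Set Plane}
    (hT : IsCell 𝓛 T) (h : IsArrangement 𝓛) (hℓ : ℓ ∈ 𝓛) {x : Plane}
    (hx : x ∈ ℓ \ ⋃₀ (𝓛 \ {ℓ})) (hxT : x ∈ closure T) :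
    ∃ U, IsOpen U ∧ x ∈ U ∧ U ∩ ℓ ⊆ closure T := by
  obtain ⟨φ, hφ, hpos⟩ := exists_chart_pos (h.isPseudoline ℓ hℓ) hT.isPreconnected (hT.disjoint hℓ)
  obtain ⟨r, hr, hsub⟩ := exists_ball_subset φ
    (h.isClosed_sUnion (sdiff_subset (s := 𝓛) (t := {ℓ}))).isOpen_compl hx.2
  have hxU : x ∈ φ '' Metric.ball (φ.symm x) r :=
    ⟨φ.symm x, Metric.mem_ball_self hr, φ.apply_symm_apply x⟩
  have hUo : IsOpen (φ '' Metric.ball (φ.symm x) r) := φ.isOpenMap _ Metric.isOpen_ball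
  -- The half-disc avoids `ℓ` by its height and the other pseudolines by the choice of `r`. It meets
  -- `T` because `T` lies above `ℓ`.
  have hVT : upperPart φ (φ.symm x) r ⊆ T := by
    refine hT.subset_of_isPreconnected (isPreconnected_upperPart _ _ _) ?_ ?_
    · rintro y hy ⟨m, hm, hym⟩
      rw [mem_upperPart] at hy
      by_cases hmℓ : m = ℓ
      · subst hmℓ
        exact hy.2.ne' ((mem_iff_height hφ y).1 hym)
      · exact hsub hy.1 ⟨m, ⟨hm, hmℓ⟩, hym⟩
    · obtain ⟨y, hyU, hyT⟩ := mem_closure_iff.1 hxT _ hUo hxU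
      exact ⟨y, mem_upperPart.2 ⟨hyU, hpos y hyT⟩, hyT⟩
  refine ⟨_, hUo, hxU, ?_⟩
  rintro _ ⟨⟨q, hq, rfl⟩, hyℓ⟩
  refine closure_mono hVT ?_
  have hq0 : q 1 = 0 := by simpa [height] using (mem_iff_height hφ _).1 hyℓ
  have hlim : Filter.Tendsto (fun ε : ℝ => q + ε • (!₂[0, 1] : Plane)) (𝓝[>] 0) (𝓝 q) := by
    have : Continuous fun ε : ℝ => q + ε • (!₂[0, 1] : Plane) := by fun_prop
    simpa using (this.tendsto 0).mono_left nhdsWithin_le_nhds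
  refine mem_closure_of_tendsto ((φ.continuous.tendsto q).comp hlim) ?_
  filter_upwards [hlim (Metric.isOpen_ball.mem_nhds hq), self_mem_nhdsWithin] with ε h1 h2
  refine ⟨_, ⟨h1, ?_⟩, rfl⟩
  simpa [hq0] using h2

/-- An edge with a boundary point of a cell is an edge of the cell. -/
theorem IsCell.connectedComponentIn_mem_edges {𝓛 : Set (Set Plane)} {T ℓ : Set Plane}
    (hT : IsCell 𝓛 T) (h : IsArrangement 𝓛) (hℓ : ℓ ∈ 𝓛) {x : Plane}
    (hx : x ∈ ℓ \ ⋃₀ (𝓛 \ {ℓ})) (hxT : x ∈ closure T) :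
    connectedComponentIn (ℓ \ ⋃₀ (𝓛 \ {ℓ})) x ∈ edges 𝓛 T := by
  refine ⟨⟨ℓ, hℓ, x, hx, rfl⟩, ?_⟩
  set E := connectedComponentIn (ℓ \ ⋃₀ (𝓛 \ {ℓ})) x with hE
  have hEsub : E ⊆ ℓ \ ⋃₀ (𝓛 \ {ℓ}) := connectedComponentIn_subset _ _
  -- If part of `E` left `closure T`, then `O` and the complement of `closure T` would disconnect
  -- `E`.
  set O : Set Plane := ⋃₀ {U | IsOpen U ∧ U ∩ ℓ ⊆ closure T} with hO
  have hOo : IsOpen O := isOpen_sUnion fun U hU => hU.1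
  have hcl : E ⊆ closure T := by
    by_contra hne
    obtain ⟨y, hyE, hy⟩ := not_subset.1 hne
    have hcov : E ⊆ O ∪ (closure T)ᶜ := by
      intro z hz
      by_cases hzT : z ∈ closure T
      · obtain ⟨U, hU, hzU, hUs⟩ := hT.exists_nhds_subset_closure h hℓ (hEsub hz) hzT
        exact Or.inl ⟨U, ⟨hU, hUs⟩, hzU⟩
      · exact Or.inr hzT
    have hxE : x ∈ E := mem_connectedComponentIn hx
    obtain ⟨z, hzE, ⟨U, ⟨-, hUs⟩, hzU⟩, hzT⟩ := isPreconnected_connectedComponentIn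
      (F := ℓ \ ⋃₀ (𝓛 \ {ℓ})) (x := x) O (closure T)ᶜ hOo isClosed_closure.isOpen_compl hcov
      ⟨x, hxE, (hcov hxE).resolve_right fun hc => hc hxT⟩ ⟨y, hyE, hy⟩
    exact hzT (hUs ⟨hzU, (hEsub hzE).1⟩)
  intro z hz
  rw [(hT.isOpen h).frontier_eq]
  exact ⟨hcl hz, fun hzT => hT.notMem_sUnion hzT ⟨ℓ, hℓ, (hEsub hz).1⟩⟩

/-- A cell with a vertex on its boundary has edges on the pseudolines through the vertex. -/
theorem IsCell.adjacent_of_vertex {𝓛 : Set (Set Plane)} {T c d : Set Plane}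
    (hT : IsCell 𝓛 T) (h : IsSimpleArrangement 𝓛) (hc : c ∈ 𝓛) (hd : d ∈ 𝓛) (hcd : c ≠ d)
    {u : Plane} (huc : u ∈ c) (hud : u ∈ d) (huT : u ∈ closure T) : Adjacent 𝓛 d T := by
  have ha := h.toIsArrangement
  suffices hs : ∃ x ∈ d \ ⋃₀ (𝓛 \ {d}), x ∈ closure T by
    obtain ⟨x, hx, hxT⟩ := hs
    exact ⟨_, hT.connectedComponentIn_mem_edges ha hd hx hxT, x, hx, rfl⟩
  obtain ⟨φ, hφ, hpos⟩ := exists_chart_pos (h.isPseudoline c hc) hT.isPreconnected (hT.disjoint hc)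
  obtain ⟨ψ, hψ⟩ := h.isPseudoline d hd
  have hu : u ∉ ⋃₀ (𝓛 \ {c, d}) := by
    rintro ⟨m, ⟨hm, hmcd⟩, hum⟩
    have h3 : ({m, c, d} : Set (Set Plane)) ⊆ {ℓ ∈ 𝓛 | u ∈ ℓ} := by
      rintro ℓ (rfl | rfl | rfl)
      · exact ⟨hm, hum⟩
      · exact ⟨hc, huc⟩
      · exact ⟨hd, hud⟩
    have := (encard_le_encard h3).trans (h.simple u)
    rw [encard_insert_of_notMem hmcd, encard_pair hcd] at this
    norm_num at this
  obtain ⟨r, hr, hsub⟩ := exists_ball_subset φ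
    (ha.isClosed_sUnion (sdiff_subset (s := 𝓛) (t := {c, d}))).isOpen_compl hu
  have huU : u ∈ φ '' Metric.ball (φ.symm u) r :=
    ⟨φ.symm u, Metric.mem_ball_self hr, φ.apply_symm_apply u⟩
  have hUo : IsOpen (φ '' Metric.ball (φ.symm u) r) := φ.isOpenMap _ Metric.isOpen_ball
  obtain ⟨t₀, rfl⟩ := exists_curve_eq hψ hud
  -- the upper branch of `d` enters the neighbourhood
  have hbranch : ∃ t, curve ψ t ∈ upperPart φ (φ.symm (curve ψ t₀)) r := by
    obtain ⟨ε, hε, hball⟩ := Metric.isOpen_iff.1 (hUo.preimage (continuous_curve ψ)) t₀ huU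
    rcases (h.crossesOnce c hc d hd hcd).sign_change hφ hψ huc with hs | hs
    · refine ⟨t₀ + ε / 2, mem_upperPart.2 ⟨hball ?_, (hs _).2.2 (by linarith)⟩⟩
      rw [Metric.mem_ball, Real.dist_eq, abs_lt]
      constructor <;> linarith
    · refine ⟨t₀ - ε / 2, mem_upperPart.2 ⟨hball ?_, (hs _).2.2 (by linarith)⟩⟩
      rw [Metric.mem_ball, Real.dist_eq, abs_lt]
      constructor <;> linarith
  have hcross : ∀ x ∈ upperPart φ (φ.symm (curve ψ t₀)) r, x ∈ ⋃₀ 𝓛 → x ∈ d \ ⋃₀ (𝓛 \ {d}) := by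
    have hm' : ∀ x ∈ upperPart φ (φ.symm (curve ψ t₀)) r, ∀ m ∈ 𝓛, x ∈ m → m = d := by
      intro x hx m hm hxm
      rw [mem_upperPart] at hx
      by_contra hmd
      refine hsub hx.1 ⟨m, ⟨hm, ?_⟩, hxm⟩
      rintro (rfl | rfl)
      · exact hx.2.ne' ((mem_iff_height hφ x).1 hxm)
      · exact hmd rfl
    rintro x hx ⟨m, hm, hxm⟩
    refine ⟨hm' x hx m hm hxm ▸ hxm, ?_⟩
    rintro ⟨m', ⟨hm𝓛, hne⟩, hxm'⟩
    exact hne (hm' x hx m' hm𝓛 hxm')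
  -- Otherwise, within the half-disc, `closure T` adds nothing to `T`; being connected, the
  -- half-disc lies in `T`, although a branch of `d` enters it.
  by_contra! hno
  have hVT : upperPart φ (φ.symm (curve ψ t₀)) r ⊆ T := by
    refine (isPreconnected_upperPart _ _ _).subset_left_of_subset_union (hT.isOpen ha)
      isClosed_closure.isOpen_compl (disjoint_left.2 fun x hx hx' => hx' (subset_closure hx))
      (fun x hx => ?_) ?_
    · by_cases hxT : x ∈ closure T
      · exact Or.inl (hT.mem_of_mem_closure ha hxT fun hx' => hno x (hcross x hx hx') hxT)
      · exact Or.inr hxT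
    · obtain ⟨y, hyU, hyT⟩ := mem_closure_iff.1 huT _ hUo huU
      exact ⟨y, mem_upperPart.2 ⟨hyU, hpos y hyT⟩, hyT⟩
  obtain ⟨t, ht⟩ := hbranch
  exact hT.notMem_sUnion (hVT ht) ⟨d, hd, curve_mem hψ t⟩

/-! ### Ends of an edge and the sides of a triangle -/

theorem IsArrangement.finite_preimage_curve {𝓛 : Set (Set Plane)} (h : IsArrangement 𝓛)
    {c : Set Plane} (hc : c ∈ 𝓛) {φ : Plane ≃ₜ Plane} (hφ : c = φ '' {x : Plane | x 1 = 0}) :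
    {s | curve φ s ∈ ⋃₀ (𝓛 \ {c})}.Finite := by
  have : {s | curve φ s ∈ ⋃₀ (𝓛 \ {c})} = ⋃ m ∈ 𝓛 \ {c}, {s | curve φ s ∈ m} := by
    ext s
    simp only [mem_sUnion, mem_ofPred_eq, mem_iUnion, exists_prop]
  rw [this]
  refine (h.finite.subset sdiff_subset).biUnion fun m hm => Subsingleton.finite ?_
  obtain ⟨v, hv⟩ := (h.crossesOnce c hc m hm.1 (Ne.symm hm.2)).1
  intro s hs t ht
  have hs' : curve φ s ∈ c ∩ m := ⟨curve_mem hφ s, hs⟩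
  have ht' : curve φ t ∈ c ∩ m := ⟨curve_mem hφ t, ht⟩
  rw [hv] at hs' ht'
  exact curve_injective φ (hs'.trans ht'.symm)

theorem curve_image_subset {𝓛 : Set (Set Plane)} {c : Set Plane} {φ : Plane ≃ₜ Plane}
    (hφ : c = φ '' {x : Plane | x 1 = 0}) {I : Set ℝ} (hI : I.OrdConnected) {t : ℝ} (ht : t ∈ I)
    (hd : ∀ s ∈ I, curve φ s ∉ ⋃₀ (𝓛 \ {c})) :
    curve φ '' I ⊆ connectedComponentIn (c \ ⋃₀ (𝓛 \ {c})) (curve φ t) := by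
  refine (hI.isPreconnected.image _ (continuous_curve φ).continuousOn).subset_connectedComponentIn
    (mem_image_of_mem _ ht) ?_
  rintro _ ⟨s, hs, rfl⟩
  exact ⟨curve_mem hφ s, hd s hs⟩

/-- An edge of a bounded cell has two ends, which lie on other pseudolines adjacent to the cell. -/
theorem IsCell.exists_ends {𝓛 : Set (Set Plane)} {T c : Set Plane} (hT : IsCell 𝓛 T)
    (h : IsSimpleArrangement 𝓛) (hb : Bornology.IsBounded T) (hc : c ∈ 𝓛) {φ : Plane ≃ₜ Plane}
    (hφ : c = φ '' {x : Plane | x 1 = 0}) {t : ℝ} (ht : curve φ t ∈ c \ ⋃₀ (𝓛 \ {c}))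
    (he : connectedComponentIn (c \ ⋃₀ (𝓛 \ {c})) (curve φ t) ⊆ frontier T) :
    ∃ d₁ ∈ 𝓛, ∃ d₂ ∈ 𝓛, d₁ ≠ c ∧ d₂ ≠ c ∧ d₁ ≠ d₂ ∧ Adjacent 𝓛 d₁ T ∧ Adjacent 𝓛 d₂ T ∧
      ∃ t₁ t₂, t₁ < t ∧ t < t₂ ∧ curve φ t₁ ∈ d₁ ∧ curve φ t₂ ∈ d₂ ∧
        curve φ '' Ioo t₁ t₂ ⊆ connectedComponentIn (c \ ⋃₀ (𝓛 \ {c})) (curve φ t) := by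
  have ha := h.toIsArrangement
  have hfin := ha.finite_preimage_curve hc hφ
  have hEb : Bornology.IsBounded (curve φ ⁻¹'
      connectedComponentIn (c \ ⋃₀ (𝓛 \ {c})) (curve φ t)) :=
    isBounded_preimage_curve φ (hb.closure.subset (he.trans frontier_subset_closure))
  have hne : ∀ s, curve φ s ∈ ⋃₀ (𝓛 \ {c}) → s ≠ t := fun s hs hst => ht.2 (hst ▸ hs)
  -- Without a crossing beyond `t`, a whole ray of the curve would lie in the edge, which is
  -- bounded, while the parametrization is proper.
  have hup : ({s | curve φ s ∈ ⋃₀ (𝓛 \ {c})} ∩ Ioi t).Nonempty := by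
    by_contra hno
    rw [not_nonempty_iff_eq_empty, eq_empty_iff_forall_notMem] at hno
    have := curve_image_subset (𝓛 := 𝓛) hφ ordConnected_Ici (self_mem_Ici (a := t)) fun s hs hs' =>
      hno s ⟨hs', lt_of_le_of_ne hs (hne s hs').symm⟩
    exact not_bddAbove_Ici (a := t) (hEb.subset (image_subset_iff.1 this)).bddAbove
  have hlow : ({s | curve φ s ∈ ⋃₀ (𝓛 \ {c})} ∩ Iio t).Nonempty := by
    by_contra hno
    rw [not_nonempty_iff_eq_empty, eq_empty_iff_forall_notMem] at hno
    have := curve_image_subset (𝓛 := 𝓛) hφ ordConnected_Iic (self_mem_Iic (a := t)) fun s hs hs' =>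
      hno s ⟨hs', lt_of_le_of_ne hs (hne s hs')⟩
    exact not_bddBelow_Iic (a := t) (hEb.subset (image_subset_iff.1 this)).bddBelow
  -- The ends are the crossings nearest to `t` on either side.
  obtain ⟨t₂, ⟨ht₂, htt₂⟩, hmin⟩ := exists_min_image _ id (hfin.inter_of_left _) hup
  obtain ⟨t₁, ⟨ht₁, htt₁⟩, hmax⟩ := exists_max_image _ id (hfin.inter_of_left _) hlow
  have htt₁' : t₁ < t := htt₁
  have htt₂' : t < t₂ := htt₂
  have hsub := curve_image_subset (𝓛 := 𝓛) hφ (I := Ioo t₁ t₂) ordConnected_Ioo ⟨htt₁', htt₂'⟩ (by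
    rintro s ⟨h1, h2⟩ hs
    rcases (hne s hs).lt_or_gt with h3 | h3
    · exact absurd (hmax s ⟨hs, h3⟩) (not_le.2 h1)
    · exact absurd (hmin s ⟨hs, h3⟩) (not_le.2 h2))
  have hcl : ∀ s ∈ Icc t₁ t₂, curve φ s ∈ closure T := by
    intro s hs
    rw [← closure_Ioo (htt₁'.trans htt₂').ne] at hs
    have := image_closure_subset_closure_image (continuous_curve φ) (mem_image_of_mem _ hs)
    exact closure_minimal (hsub.trans (he.trans frontier_subset_closure)) isClosed_closure this
  obtain ⟨d₁, ⟨hd₁, hd₁c⟩, htd₁⟩ := ht₁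
  obtain ⟨d₂, ⟨hd₂, hd₂c⟩, htd₂⟩ := ht₂
  have hle : t₁ ≤ t₂ := (htt₁'.trans htt₂').le
  refine ⟨d₁, hd₁, d₂, hd₂, hd₁c, hd₂c, ?_,
    hT.adjacent_of_vertex h hc hd₁ (Ne.symm hd₁c) (curve_mem hφ t₁) htd₁ (hcl _ ⟨le_rfl, hle⟩),
    hT.adjacent_of_vertex h hc hd₂ (Ne.symm hd₂c) (curve_mem hφ t₂) htd₂ (hcl _ ⟨hle, le_rfl⟩),
    t₁, t₂, htt₁', htt₂', htd₁, htd₂, hsub⟩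
  rintro rfl
  obtain ⟨v, hv⟩ := (h.crossesOnce c hc d₁ hd₁ (Ne.symm hd₁c)).1
  have h1 : curve φ t₁ ∈ c ∩ d₁ := ⟨curve_mem hφ _, htd₁⟩
  have h2 : curve φ t₂ ∈ c ∩ d₁ := ⟨curve_mem hφ _, htd₂⟩
  rw [hv] at h1 h2
  exact (htt₁'.trans htt₂').ne (curve_injective φ (h1.trans h2.symm))

theorem IsEdgeOn.unique {𝓛 : Set (Set Plane)} {ℓ m e : Set Plane} (hm : m ∈ 𝓛)
    (h₁ : IsEdgeOn 𝓛 ℓ e) (h₂ : IsEdgeOn 𝓛 m e) : m = ℓ := by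
  obtain ⟨x, hx, rfl⟩ := h₁
  obtain ⟨y, hy, hxy⟩ := h₂
  by_contra hne
  have : x ∈ connectedComponentIn (m \ ⋃₀ (𝓛 \ {m})) y := hxy ▸ mem_connectedComponentIn hx
  exact notMem_of_mem_diff hx hm hne (connectedComponentIn_subset _ _ this).1

theorem Adjacent.exists_curve {𝓛 : Set (Set Plane)} {ℓ T : Set Plane} {φ : Plane ≃ₜ Plane}
    (hφ : ℓ = φ '' {x : Plane | x 1 = 0}) (h : Adjacent 𝓛 ℓ T) :
    ∃ t, curve φ t ∈ ℓ \ ⋃₀ (𝓛 \ {ℓ}) ∧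
      connectedComponentIn (ℓ \ ⋃₀ (𝓛 \ {ℓ})) (curve φ t) ∈ edges 𝓛 T := by
  obtain ⟨e, he, x, hx, rfl⟩ := h
  obtain ⟨t, rfl⟩ := exists_curve_eq hφ hx.1
  exact ⟨t, hx, he⟩

/-- The pseudolines adjacent to a triangle. -/
theorem IsTriangle.exists_lines {𝓛 : Set (Set Plane)} {T : Set Plane} (hT : IsTriangle 𝓛 T)
    (h : IsSimpleArrangement 𝓛) :
    ∃ a ∈ 𝓛, ∃ b ∈ 𝓛, ∃ c ∈ 𝓛, a ≠ b ∧ a ≠ c ∧ b ≠ c ∧ Adjacent 𝓛 a T ∧ Adjacent 𝓛 b T ∧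
      Adjacent 𝓛 c T ∧ ∀ ℓ ∈ 𝓛, Adjacent 𝓛 ℓ T → ℓ = a ∨ ℓ = b ∨ ℓ = c := by
  obtain ⟨⟨hcell, hb⟩, hcard⟩ := hT
  have hne : (edges 𝓛 T).Nonempty := by
    rw [← encard_ne_zero, hcard]
    norm_num
  obtain ⟨e, he⟩ := hne
  obtain ⟨a, ha, hea⟩ := he.1
  obtain ⟨φ, hφ⟩ := h.isPseudoline a ha
  have haT : Adjacent 𝓛 a T := ⟨e, he, hea⟩
  obtain ⟨t, ht, het⟩ := haT.exists_curve hφ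
  obtain ⟨b, hbL, c, hc, hba, hca, hbc, hbT, hcT, -⟩ := hcell.exists_ends h hb ha hφ ht het.2
  refine ⟨a, ha, b, hbL, c, hc, hba.symm, hca.symm, hbc, haT, hbT, hcT, ?_⟩
  obtain ⟨eb, heb, hebb⟩ := hbT
  obtain ⟨ec, hec, hecc⟩ := hcT
  have h1 : e ≠ eb := by
    rintro rfl
    exact hba (hea.unique hbL hebb)
  have h2 : e ≠ ec := by
    rintro rfl
    exact hca (hea.unique hc hecc)
  have h3 : eb ≠ ec := by
    rintro rfl
    exact hbc (hecc.unique hbL hebb)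
  have hcard3 : ({e, eb, ec} : Set (Set Plane)).encard = 3 := by
    rw [encard_insert_of_notMem (by simp [h1, h2]), encard_pair h3]
    norm_num
  have hsub : ({e, eb, ec} : Set (Set Plane)) ⊆ edges 𝓛 T := by
    rintro f (rfl | rfl | rfl) <;> assumption
  have hfin : (edges 𝓛 T).Finite := finite_of_encard_eq_coe (k := 3) hcard
  have heq := (hfin.subset hsub).eq_of_subset_of_encard_le hsub (by rw [hcard, hcard3])
  rintro ℓ hℓ ⟨f, hf, hfℓ⟩
  rw [← heq] at hf
  rcases hf with rfl | rfl | rfl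
  · exact Or.inl (hea.unique hℓ hfℓ)
  · exact Or.inr (Or.inl (hebb.unique hℓ hfℓ))
  · exact Or.inr (Or.inr (hecc.unique hℓ hfℓ))

/-! ### Separation of two cells -/

/-- The pseudoline with chart `φ` separates points of the two sets. -/
def Separates (φ : Plane ≃ₜ Plane) (T P : Set Plane) : Prop :=
  ∃ x ∈ T, ∃ y ∈ P, height φ x * height φ y < 0

theorem IsCell.height_mul_pos {𝓛 : Set (Set Plane)} {T ℓ : Set Plane} (hT : IsCell 𝓛 T)
    (hℓ : ℓ ∈ 𝓛) {φ : Plane ≃ₜ Plane} (hφ : ℓ = φ '' {x : Plane | x 1 = 0}) {x y : Plane}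
    (hx : x ∈ T) (hy : y ∈ closure T) (hy' : y ∉ ℓ) : 0 < height φ x * height φ y := by
  have hne : height φ y ≠ 0 := fun h0 => hy' ((mem_iff_height hφ y).2 h0)
  have hcont := continuous_height φ
  rcases height_pos_or_neg hφ hT.isPreconnected (hT.disjoint hℓ) with h | h
  · have : 0 ≤ height φ y := closure_minimal (s := T) (t := {z | 0 ≤ height φ z})
      (fun z hz => (h z hz).le) (isClosed_le continuous_const hcont) hy
    exact mul_pos (h x hx) (lt_of_le_of_ne this hne.symm)
  · have : height φ y ≤ 0 := closure_minimal (s := T) (t := {z | height φ z ≤ 0})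
      (fun z hz => (h z hz).le) (isClosed_le hcont continuous_const) hy
    exact mul_pos_of_neg_of_neg (h x hx) (lt_of_le_of_ne this hne)

/-- A cell lies on one side of `ℓ`, so any points of the closures off `ℓ` can test separation. This
allows points taken on edges along a third pseudoline. -/
theorem separates_iff {𝓛 : Set (Set Plane)} {T P ℓ : Set Plane} (hT : IsCell 𝓛 T)
    (hP : IsCell 𝓛 P) (hℓ : ℓ ∈ 𝓛) {φ : Plane ≃ₜ Plane} (hφ : ℓ = φ '' {x : Plane | x 1 = 0})
    {x y : Plane} (hx : x ∈ closure T) (hx' : x ∉ ℓ) (hy : y ∈ closure P) (hy' : y ∉ ℓ) :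
    Separates φ T P ↔ height φ x * height φ y < 0 := by
  have key : ∀ p ∈ T, ∀ q ∈ P,
      (height φ p * height φ q < 0 ↔ height φ x * height φ y < 0) := by
    intro p hp q hq
    have h1 := hT.height_mul_pos hℓ hφ hp hx hx'
    have h2 := hP.height_mul_pos hℓ hφ hq hy hy'
    have h3 : 0 < (height φ p * height φ q) * (height φ x * height φ y) := by
      have := mul_pos h1 h2
      linarith
    exact ⟨fun h => neg_of_mul_pos_right h3 h.le, fun h => neg_of_mul_pos_left h3 h.le⟩
  constructor
  · rintro ⟨p, hp, q, hq, hpq⟩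
    exact (key p hp q hq).1 hpq
  · intro hxy
    obtain ⟨p, hp⟩ := hT.nonempty
    obtain ⟨q, hq⟩ := hP.nonempty
    exact ⟨p, hp, q, hq, (key p hp q hq).2 hxy⟩

theorem CrossesOnce.height_mul_neg_iff {ℓ m : Set Plane} {φ ψ : Plane ≃ₜ Plane}
    (h : CrossesOnce ℓ m) (hℓ : ℓ = φ '' {x : Plane | x 1 = 0})
    (hm : m = ψ '' {x : Plane | x 1 = 0}) {t₀ : ℝ} (ht₀ : curve ψ t₀ ∈ ℓ) (s t : ℝ) :
    height φ (curve ψ s) * height φ (curve ψ t) < 0 ↔ (s < t₀ ∧ t₀ < t) ∨ (t < t₀ ∧ t₀ < s) := by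
  rw [mul_neg_iff]
  rcases h.sign_change hℓ hm ht₀ with h | h <;>
    rw [(h s).1, (h s).2, (h t).1, (h t).2] <;> tauto

/-- If a bounded cell `T` and a cell `P` have edges on the same pseudoline `c`, then they share that
edge or exactly one of the pseudolines through the ends of the edge of `T` separates them. -/
theorem common_edge_or_separates {𝓛 : Set (Set Plane)} {T P c : Set Plane} (hT : IsCell 𝓛 T)
    (hP : IsCell 𝓛 P) (h : IsSimpleArrangement 𝓛) (hb : Bornology.IsBounded T) (hc : c ∈ 𝓛)
    (hcT : Adjacent 𝓛 c T) (hcP : Adjacent 𝓛 c P) :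
    ∃ d₁ ∈ 𝓛, ∃ d₂ ∈ 𝓛, d₁ ≠ c ∧ d₂ ≠ c ∧ d₁ ≠ d₂ ∧ Adjacent 𝓛 d₁ T ∧ Adjacent 𝓛 d₂ T ∧
      ∀ φ₁ φ₂ : Plane ≃ₜ Plane, d₁ = φ₁ '' {x : Plane | x 1 = 0} →
        d₂ = φ₂ '' {x : Plane | x 1 = 0} → (∃ e, e ∈ edges 𝓛 T ∧ e ∈ edges 𝓛 P) ∨
          (Separates φ₁ T P ↔ ¬ Separates φ₂ T P) := by
  obtain ⟨φ, hφ⟩ := h.isPseudoline c hc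
  obtain ⟨t, ht, het⟩ := hcT.exists_curve hφ
  obtain ⟨s, hs, hes⟩ := hcP.exists_curve hφ
  obtain ⟨d₁, hd₁, d₂, hd₂, h1c, h2c, h12, h1T, h2T, t₁, t₂, ht₁, ht₂, htd₁, htd₂, hsub⟩ :=
    hT.exists_ends h hb hc hφ ht het.2
  refine ⟨d₁, hd₁, d₂, hd₂, h1c, h2c, h12, h1T, h2T, fun φ₁ φ₂ hφ₁ hφ₂ => ?_⟩
  have htT := frontier_subset_closure (het.2 (mem_connectedComponentIn ht))
  have hsP := frontier_subset_closure (hes.2 (mem_connectedComponentIn hs))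
  rw [separates_iff hT hP hd₁ hφ₁ htT (notMem_of_mem_diff ht hd₁ h1c) hsP
      (notMem_of_mem_diff hs hd₁ h1c),
    separates_iff hT hP hd₂ hφ₂ htT (notMem_of_mem_diff ht hd₂ h2c) hsP
      (notMem_of_mem_diff hs hd₂ h2c),
    (h.crossesOnce d₁ hd₁ c hc h1c).height_mul_neg_iff hφ₁ hφ htd₁,
    (h.crossesOnce d₂ hd₂ c hc h2c).height_mul_neg_iff hφ₂ hφ htd₂]
  have hs1 : s ≠ t₁ := by
    rintro rfl
    exact notMem_of_mem_diff hs hd₁ h1c htd₁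
  have hs2 : s ≠ t₂ := by
    rintro rfl
    exact notMem_of_mem_diff hs hd₂ h2c htd₂
  -- Between the ends, the two edges are the same component. Outside, exactly one of `t₁`, `t₂` lies
  -- between `s` and `t`.
  by_cases hst : s ∈ Ioo t₁ t₂
  · left
    refine ⟨_, het, ?_⟩
    rwa [connectedComponentIn_eq (hsub (mem_image_of_mem _ hst))]
  · right
    rw [mem_Ioo] at hst
    grind

end Pseudolines

theorem mainTheorem7 (𝓛 : Set (Set Pseudolines.Plane)) (h𝓛 : 𝓛 ∈ Pseudolines.ImClass)
    (P : Set Pseudolines.Plane) (hP : Pseudolines.IsGeFiveGon 𝓛 P)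
    (T : Set Pseudolines.Plane) (hT : Pseudolines.IsTriangle 𝓛 T) :
    ∃ e, e ∈ Pseudolines.edges 𝓛 T ∧ e ∈ Pseudolines.edges 𝓛 P := by
  obtain ⟨h, P', -, huniq, hadj⟩ := h𝓛
  obtain rfl := huniq P hP
  obtain ⟨a, ha, b, hb, c, hc, hab, hac, hbc, haT, hbT, hcT, hall⟩ := hT.exists_lines h
  obtain ⟨φa, hφa⟩ := h.isPseudoline a ha
  obtain ⟨φb, hφb⟩ := h.isPseudoline b hb
  obtain ⟨φc, hφc⟩ := h.isPseudoline c hc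
  by_contra hno
  have key : ∀ x y z : Set Pseudolines.Plane, ∀ φy φz : Pseudolines.Plane ≃ₜ Pseudolines.Plane,
      x ∈ 𝓛 → Pseudolines.Adjacent 𝓛 x T → y = φy '' {p | p 1 = 0} → z = φz '' {p | p 1 = 0} →
      (∀ ℓ ∈ 𝓛, Pseudolines.Adjacent 𝓛 ℓ T → ℓ = x ∨ ℓ = y ∨ ℓ = z) →
      (Pseudolines.Separates φy T P ↔ ¬ Pseudolines.Separates φz T P) := by
    intro x y z φy φz hx hxT hy hz hall
    obtain ⟨d₁, hd₁, d₂, hd₂, h1, h2, h12, h1T, h2T, hsep⟩ :=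
      Pseudolines.common_edge_or_separates hT.1.1 hP.1.1 h hT.1.2 hx hxT (hadj x hx)
    -- The ends come in unknown order; the exclusive alternative is symmetric in `y` and `z`.
    rcases (hall d₁ hd₁ h1T).resolve_left h1 with rfl | rfl <;>
      rcases (hall d₂ hd₂ h2T).resolve_left h2 with rfl | rfl
    · exact absurd rfl h12
    · exact (hsep φy φz hy hz).resolve_left hno
    · have := (hsep φz φy hz hy).resolve_left hno
      tauto
    · exact absurd rfl h12
  have k1 := key a b c φb φc ha haT hφb hφc hall
  have k2 := key b a c φa φc hb hbT hφa hφc fun ℓ hℓ hℓT => by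
    have := hall ℓ hℓ hℓT
    tauto
  have k3 := key c a b φa φb hc hcT hφa hφb fun ℓ hℓ hℓT => by
    have := hall ℓ hℓ hℓT
    tauto
  -- Three propositions cannot be pairwise inequivalent.
  tauto
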